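/- Let $N\ge 1$ be an integer, let $m_{bn},m_{nd},\Omega_{bn},\Omega_{nd}>0$ and $\lambda,\psi,\Upsilon_{th}>0$ be real numbers, and put $$\mu_{\mathfrak D}=N\,R\left(\frac{\Omega_{bn}\Omega_{nd}}{m_{bn}m_{nd}}\right)^{1/2},\qquad \sigma^2_{\mathfrak D}=N\,\Omega_{bn}\Omega_{nd}\left[1-\frac{R^2}{m_{bn}m_{nd}}\right],\qquad R=\frac{\Gamma(m_{bn}+\frac12)\,\Gamma(m_{nd}+\frac12)}{\Gamma(m_{bn})\,\Gamma(m_{nd})},$$ $\delta=\mu_{\mathfrak D}^2/\sigma_{\mathfrak D}^2$ and $\zeta=\sigma_{\mathfrak D}^2/\mu_{\mathfrak D}$. Then $\delta>0$ and $\zeta>0$. For real $d>0$ let $F_{X,d}(x)=\gamma(d,\sqrt{x}/\zeta)/\Gamma(d)$ for $x\ge 0$ and $F_{X,d}(x)=0$ for $x<0$, where $\gamma$ is the lower incomplete gamma function, let $$f_Y(y)=\left(\frac{m_{nd}}{\Omega_{nd}}\right)^{m_{nd}N}\frac{y^{m_{nd}N-1}}{\Gamma(m_{nd}N)}\,e^{-\frac{m_{nd}}{\Omega_{nd}}y}\quad(y>0),\qquad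 \xi_1(d)=\int_0^\infty f_Y(y)\,F_{X,d}\!\left(\frac{\lambda\Upsilon_{th}\,y}{\psi}\right)dy .$$ For every integer $d\ge 1$ the integral $\xi_1(d)$ converges and $$\xi_1(d)=1-\sum_{p=0}^{d-1}\frac{1}{p!\sqrt{\pi}}\left(\frac{m_{nd}}{\Omega_{nd}}\right)^{-p/2}\left(\frac1\zeta\sqrt{\frac{\Upsilon_{th}\lambda}{\psi}}\right)^{p}\frac{1}{\Gamma(m_{nd}N)}\;G^{2,1}_{1,2}\!\left(\frac{\lambda\,\Omega_{nd}\Upsilon_{th}}{4\psi\, m_{nd}\zeta^2}\,\middle|\,\begin{matrix}1-m_{nd}N-\frac p2\\ 0,\ \frac12\end{matrix}\right).$$ Here $G^{2,1}_{1,2}\left(z\,\middle|\begin{matrix}a\\ b_1,b_2\end{matrix}\right)=\frac1{2\pi i}\int_{\mathrm{Re}\, s=c}\Gamma(b_1-s)\Gamma(b_2-s)\Gamma(1-a+s)\,z^s\,ds$ is the Meijer G-function; for the parameters and the argument above this integral converges absolutely, and has the same value, for every $c$ with $a-1<c<\min(b_1,b_2)$, and such $c$ exist. In particular the formula holds with $d=\lceil\delta\rceil$,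 the positive integer value used for the shape $\delta$, and with $d=\delta$ when $\delta$ is itself an integer. Moreover, let $g_{1d},\dots,g_{Nd}$ be independent complex random variables whose moduli are Nakagami-$m$ distributed with shape $m_{nd}$ and average power $\Omega_{nd}$, let $Y=\sum_{n=1}^N|g_{nd}|^2$, let $d\ge 1$ be an integer, and let $X$ be a real random variable with CDF $F_{X,d}$, independent of $Y$. Then $Y$ has the Gamma density $f_Y$, and $\Pr\left[\dfrac{\psi X}{\lambda Y}<\Upsilon_{th}\right]=\xi_1(d)$. -/

import Mathlib

open MeasureTheory ProbabilityTheory Set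

noncomputable section

/-! ### The Meijer G-function -/

/-- The Mellin–Barnes kernel
`∏_{j<m} Γ(b_j - s) ∏_{j<n} Γ(1 - a_j + s) / (∏_{j≥m} Γ(1 - b_j + s) ∏_{j≥n} Γ(a_j - s))`
of `G^{m,n}_{p,q}` with parameters `a_0, …, a_{p-1}` and `b_0, …, b_{q-1}`. -/
def meijerKernel {p q : ℕ} (m n : ℕ) (a : Fin p → ℂ) (b : Fin q → ℂ) (s : ℂ) : ℂ :=
  ((∏ j ∈ Finset.univ.filter (fun j : Fin q => (j : ℕ) < m), Complex.Gamma (b j - s)) *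
      ∏ j ∈ Finset.univ.filter (fun j : Fin p => (j : ℕ) < n), Complex.Gamma (1 - a j + s)) /
    ((∏ j ∈ Finset.univ.filter (fun j : Fin q => m ≤ (j : ℕ)), Complex.Gamma (1 - b j + s)) *
      ∏ j ∈ Finset.univ.filter (fun j : Fin p => n ≤ (j : ℕ)), Complex.Gamma (a j - s))

/-- The upward vertical line `Re s = c` separates the poles of `Γ(b_j - s)`, `j < m` (all to its
right) from the poles of `Γ(1 - a_j + s)`, `j < n` (all to its left). -/
def IsMeijerContour {p q : ℕ} (m n : ℕ) (a : Fin p → ℂ) (b : Fin q → ℂ) (c : ℝ) : Prop :=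
  (∀ j : Fin p, (j : ℕ) < n → (a j).re - 1 < c) ∧ (∀ j : Fin q, (j : ℕ) < m → c < (b j).re)

/-- The integrand `kernel(s) z^s` at the point `s = c + it` of the line `Re s = c`. -/
def meijerIntegrand {p q : ℕ} (m n : ℕ) (a : Fin p → ℂ) (b : Fin q → ℂ) (z : ℂ) (c t : ℝ) : ℂ :=
  meijerKernel m n a b (c + t * Complex.I) * z ^ ((c : ℂ) + t * Complex.I)

/-- `(2πi)⁻¹ ∫ kernel(s) z^s ds` over the upward line `Re s = c` (where `ds = i dt`). -/
def meijerLineIntegral {p q : ℕ} (m n : ℕ) (a : Fin p → ℂ) (b : Fin q → ℂ) (z : ℂ) (c : ℝ) : ℂ :=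
  (1 / (2 * Real.pi : ℂ)) * ∫ t : ℝ, meijerIntegrand m n a b z c t

open Classical in
/-- The Meijer G-function `G^{m,n}_{p,q}(z | a; b)`, as the Mellin–Barnes integral over a vertical
line that separates the two families of poles. It is meant for parameters for which such a line
exists (the value is set to `0` otherwise). -/
def meijerG {p q : ℕ} (m n : ℕ) (a : Fin p → ℂ) (b : Fin q → ℂ) (z : ℂ) : ℂ :=
  if h : ∃ c : ℝ, IsMeijerContour m n a b c then meijerLineIntegral m n a b z h.choose else 0

/-! ### Distributions -/

/-- The lower incomplete gamma function `γ(s, x) = ∫_0^x t^{s-1} e^{-t} dt`. -/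
def lowerIncGamma (s x : ℝ) : ℝ := ∫ t in (0 : ℝ)..x, t ^ (s - 1) * Real.exp (-t)

/-- The Nakagami-`m` law with shape `m` and average power `Om`: its density is
`2 m^m / (Γ(m) Om^m) x^{2m-1} exp(-m x² / Om)` on `x > 0`. -/
def nakagamiMeasure (m Om : ℝ) : Measure ℝ :=
  volume.withDensity fun x => ENNReal.ofReal
    (if 0 < x then
      2 * m ^ m / (Real.Gamma m * Om ^ m) * x ^ (2 * m - 1) * Real.exp (-(m / Om) * x ^ 2)
    else 0)

/-- The model CDF `F_X(x) = γ(d, √x / ζ) / Γ(d)` of the squared cascaded amplitude, with shape `d`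
and scale `ζ` (it is `0` for `x ≤ 0`, as `√x = 0` there). -/
def cascadeCDF (d ζ x : ℝ) : ℝ := lowerIncGamma d (Real.sqrt x / ζ) / Real.Gamma d

/-- The mean `μ_D` of the cascaded amplitude. -/
def cascadeMean (N : ℕ) (mb md Ob Od : ℝ) : ℝ :=
  Real.Gamma (mb + 1 / 2) * Real.Gamma (md + 1 / 2) / (Real.Gamma mb * Real.Gamma md) *
    ((Ob * Od) / (mb * md)) ^ (1 / 2 : ℝ) * N

/-- The variance `σ²_D` of the cascaded amplitude. -/
def cascadeVar (N : ℕ) (mb md Ob Od : ℝ) : ℝ :=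
  N * (Ob * Od) * (1 - 1 / (mb * md) *
    (Real.Gamma (mb + 1 / 2) * Real.Gamma (md + 1 / 2) / (Real.Gamma mb * Real.Gamma md)) ^ 2)

/-! ### The term `ξ₁` -/

/-- The integrand `f_Y(y) F_X(λ Υ y / ψ)`, where `f_Y` is the Gamma density with shape `md N` and
rate `md / Od`, and `F_X` has shape `d` and scale `ζ`. -/
def xi1Integrand (N : ℕ) (md Od lam psi Ups ζ d y : ℝ) : ℝ :=
  gammaPDFReal (md * N) (md / Od) y * cascadeCDF d ζ (lam * Ups * y / psi)

/-- `ξ₁ = ∫_0^∞ f_Y(y) F_X(λ Υ y / ψ) dy`. -/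
def xi1 (N : ℕ) (md Od lam psi Ups ζ d : ℝ) : ℝ :=
  ∫ y in Ioi (0 : ℝ), xi1Integrand N md Od lam psi Ups ζ d y

/-- The upper parameter `1 - md N - p/2` of the G-function in the `p`-th summand. -/
def upperParam (N : ℕ) (md : ℝ) (p : ℕ) : Fin 1 → ℂ :=
  ![((1 - md * N - p / 2 : ℝ) : ℂ)]

/-- The lower parameters `0, 1/2`. -/
def lowerParam : Fin 2 → ℂ := ![0, 1 / 2]

/-- The argument `λ Od Υ / (4 ψ md ζ²)` of the G-function. -/
def meijerArg (md Od lam psi Ups ζ : ℝ) : ℝ := lam * Od * Ups / (4 * psi * md * ζ ^ 2)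

/-- The closed form
`1 - ∑_{p<d} 1/(p! √π) (md/Od)^{-p/2} (ζ⁻¹ √(Υλ/ψ))^p 1/Γ(md N) G^{2,1}_{1,2}(…)`. -/
def xi1ClosedForm (N : ℕ) (md Od lam psi Ups ζ : ℝ) (d : ℕ) : ℂ :=
  1 - ∑ p ∈ Finset.range d,
    ((1 / ((p.factorial : ℝ) * Real.sqrt Real.pi) * (md / Od) ^ (-(p : ℝ) / 2) *
        (1 / ζ * Real.sqrt (Ups * lam / psi)) ^ p * (1 / Real.Gamma (md * N)) : ℝ) : ℂ) *
      meijerG 2 1 (upperParam N md p) lowerParam (meijerArg md Od lam psi Ups ζ : ℂ)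

end

/-! For an integer shape `d` the CDF is elementary: `1 - exp(-√x/ζ) ∑_{p<d} (√x/ζ)^p / p!`. Against
the Gamma density the constant 1 integrates to 1, and the `p`-th term gives a multiple of `∫ y^(κ-1)
exp(-β y - A √y) dy` over `y > 0`, where `κ = md N + p/2`, `β = md/Od` and `A = ζ⁻¹ √(Υλ/ψ)`.

The G-function is brought to the same form. Duplication turns `Γ(-s) Γ(1/2-s)` into `2√π 4^s
Γ(-2s)`, and Euler's integral replaces `Γ(κ+s)`. After Fubini, the contour integral is Mellin
inversion of `exp(-x)` at `x = 2√(zy)`, so `G = √π ∫ y^(κ-1) exp(-y - 2√(zy)) dy`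
(`meijerLineIntegral_two_one`). The abscissa `c` has disappeared, and rescaling `y` by `β` matches
the terms when `z = A²/(4β)`.

On the probabilistic side, squared Nakagami moduli are Gamma distributed, their independent sum is
Gamma by moment generating functions, and conditioning on `Y` yields `ξ₁`. Positivity of the
variance rests on `Γ(m+1/2)² < m Γ(m)²`. -/

/-! ### The Gamma function on vertical lines, and Mellin inversion of the exponential. -/

/-- On a vertical line in the right half-plane the Gamma function is bounded by its value on the
real axis. -/
theorem norm_Gamma_le_Gamma_re {s : ℂ} (hs : 0 < s.re) :
    ‖Complex.Gamma s‖ ≤ Real.Gamma s.re := by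
  rw [Complex.Gamma_eq_integral hs, Real.Gamma_eq_integral hs, Complex.GammaIntegral]
  refine (norm_integral_le_integral_norm _).trans_eq ?_
  refine setIntegral_congr_fun measurableSet_Ioi fun x hx => ?_
  have hx' : (0 : ℝ) < x := hx
  simp only [norm_mul, Complex.norm_real, Complex.norm_cpow_eq_rpow_re_of_pos hx',
    Real.norm_eq_abs, abs_of_pos (Real.exp_pos _), Complex.sub_re, Complex.one_re]

theorem continuous_Gamma_vertical {σ : ℝ} (hσ : 0 < σ) :
    Continuous fun t : ℝ => Complex.Gamma (σ + t * Complex.I) := by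
  rw [continuous_iff_continuousAt]
  intro t
  have h : ContinuousAt Complex.Gamma ((σ : ℂ) + t * Complex.I) := by
    refine (Complex.differentiableAt_Gamma _ fun m hm => ?_).continuousAt
    have := congrArg Complex.re hm
    simp at this
    have hm0 : (0 : ℝ) ≤ m := m.cast_nonneg
    linarith
  exact ContinuousAt.comp (f := fun t : ℝ => (σ : ℂ) + t * Complex.I) h (by fun_prop)

/-- The Gamma function is integrable on vertical lines in the right half-plane. -/
theorem integrable_Gamma_vertical {σ : ℝ} (hσ : 0 < σ) :
    Integrable fun t : ℝ => Complex.Gamma (σ + t * Complex.I) := by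
  -- The dominating function is `Γ(σ+2) / (σ² + t²)`: two uses of the functional equation give `|s|²
  -- |Γ(s)| ≤ |Γ(s+2)|`.
  have hdom : Integrable fun t : ℝ =>
      Real.Gamma (σ + 2) * ((σ ^ 2)⁻¹ * (1 + (t / σ) ^ 2)⁻¹) :=
    ((integrable_inv_one_add_sq.comp_div hσ.ne').const_mul _).const_mul _
  refine hdom.mono' (continuous_Gamma_vertical hσ).aestronglyMeasurable (ae_of_all _ fun t => ?_)
  set s : ℂ := σ + t * Complex.I with hs
  have hre : s.re = σ := by simp [hs]
  have him : s.im = t := by simp [hs]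
  have h0 : s ≠ 0 := fun h => by rw [h] at hre; simp at hre; linarith
  have h1 : s + 1 ≠ 0 := fun h => by
    have := congrArg Complex.re h
    simp only [Complex.add_re, hre, Complex.one_re, Complex.zero_re] at this
    linarith
  have hrec : Complex.Gamma (s + 2) = (s + 1) * (s * Complex.Gamma s) := by
    rw [← Complex.Gamma_add_one s h0, ← Complex.Gamma_add_one (s + 1) h1]
    congr 1; ring
  have hb : ‖Complex.Gamma (s + 2)‖ ≤ Real.Gamma (σ + 2) := by
    have := norm_Gamma_le_Gamma_re (s := s + 2) (by simp [hre]; linarith)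
    simpa [hre] using this
  have hns : ‖s‖ ^ 2 = σ ^ 2 + t ^ 2 := by
    rw [Complex.sq_norm, Complex.normSq_apply, hre, him]; ring
  have hs1 : ‖s‖ ≤ ‖s + 1‖ := by
    rw [← sq_le_sq₀ (norm_nonneg _) (norm_nonneg _), Complex.sq_norm, Complex.sq_norm,
      Complex.normSq_apply, Complex.normSq_apply]
    simp only [Complex.add_re, Complex.add_im, Complex.one_re, Complex.one_im, hre, him]
    nlinarith
  have hpos : 0 < σ ^ 2 + t ^ 2 := by positivity
  have hrhs : (σ ^ 2)⁻¹ * (1 + (t / σ) ^ 2)⁻¹ = (σ ^ 2 + t ^ 2)⁻¹ := by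
    rw [← mul_inv]; congr 1; field_simp
  rw [hrhs, ← div_eq_mul_inv, le_div_iff₀ hpos, ← hns]
  refine le_trans ?_ hb
  rw [hrec, norm_mul, norm_mul, sq]
  nlinarith [norm_nonneg s, norm_nonneg (Complex.Gamma s),
    mul_le_mul_of_nonneg_right hs1 (mul_nonneg (norm_nonneg s) (norm_nonneg (Complex.Gamma s)))]

/-- Mellin inversion: `Γ` is the Mellin transform of `exp(-x)`, and its integrability on the line
permits inversion. -/
theorem integral_cpow_mul_Gamma_vertical {σ x : ℝ} (hσ : 0 < σ) (hx : 0 < x) :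
    ∫ t : ℝ, (x : ℂ) ^ (-(σ + t * Complex.I)) * Complex.Gamma (σ + t * Complex.I) =
      2 * Real.pi * (Real.exp (-x) : ℂ) := by
  have hΓ : ∀ t : ℝ, mellin (fun x : ℝ => (Real.exp (-x) : ℂ)) (σ + t * Complex.I) =
      Complex.Gamma (σ + t * Complex.I) := fun t => by
    rw [← Complex.GammaIntegral_eq_mellin, Complex.Gamma_eq_integral (by simpa using hσ)]
  have hconv : MellinConvergent (fun x : ℝ => (Real.exp (-x) : ℂ)) σ := by
    have := Complex.GammaIntegral_convergent (s := σ) (by simpa using hσ)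
    refine this.congr_fun (fun y _ => ?_) measurableSet_Ioi
    simp [mul_comm]
  have hvert : Complex.VerticalIntegrable (mellin fun x : ℝ => (Real.exp (-x) : ℂ)) σ := by
    unfold Complex.VerticalIntegrable
    simp_rw [hΓ]
    exact integrable_Gamma_vertical hσ
  have h := mellinInv_mellin_eq σ (fun x : ℝ => (Real.exp (-x) : ℂ)) hx hconv hvert (by fun_prop)
  rw [mellinInv] at h
  simp_rw [hΓ, smul_eq_mul] at h
  rw [← h]
  rw [Complex.real_smul, ← mul_assoc]
  have h2π : 2 * (Real.pi : ℂ) * ((1 / (2 * Real.pi) : ℝ) : ℂ) = 1 := by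
    have : (Real.pi : ℂ) ≠ 0 := Complex.ofReal_ne_zero.mpr Real.pi_ne_zero
    push_cast
    field_simp
  rw [h2π, one_mul]

/-! ### The function `G^{2,1}_{1,2}` as a Laplace-type integral. -/

/-- Legendre duplication at `-s` merges the two Gamma factors coming from `0` and `1/2`. -/
theorem meijerKernel_two_one (α s : ℂ) :
    meijerKernel 2 1 ![α] lowerParam s =
      2 * Real.sqrt Real.pi * (4 : ℂ) ^ s * Complex.Gamma (-(2 * s)) *
        Complex.Gamma (1 - α + s) := by
  have hdup := Complex.Gamma_mul_Gamma_add_half (-s)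
  have h4 : (2 : ℂ) ^ (1 - 2 * -s) = 2 * (4 : ℂ) ^ s := by
    rw [show (1 : ℂ) - 2 * -s = 1 + 2 * s by ring, Complex.cpow_add _ _ two_ne_zero,
      Complex.cpow_one, Complex.cpow_ofNat_mul]
    congr 1
    rw [sq, show (4 : ℂ) = ((2 : ℝ) : ℂ) * ((2 : ℝ) : ℂ) by norm_num,
      Complex.mul_cpow_ofReal_nonneg zero_le_two zero_le_two]
    norm_num
  have e1 : (Finset.univ.filter fun j : Fin 2 => (j : ℕ) < 2) = Finset.univ := by decide
  have e2 : (Finset.univ.filter fun j : Fin 1 => (j : ℕ) < 1) = Finset.univ := by decide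
  have e3 : (Finset.univ.filter fun j : Fin 2 => 2 ≤ (j : ℕ)) = ∅ := by decide
  have e4 : (Finset.univ.filter fun j : Fin 1 => 1 ≤ (j : ℕ)) = ∅ := by decide
  unfold meijerKernel
  rw [e1, e2, e3, e4]
  simp only [Fin.prod_univ_two, lowerParam, Finset.prod_empty, Matrix.cons_val_zero,
    Matrix.cons_val_one, Finset.univ_unique, Finset.prod_singleton, Fin.default_eq_zero,
    zero_sub, mul_one, div_one]
  rw [show (1 : ℂ) / 2 - s = -s + 1 / 2 by ring, hdup, h4,
    show (2 : ℂ) * -s = -(2 * s) by ring]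
  ring

theorem isMeijerContour_two_one_iff {α c : ℝ} :
    IsMeijerContour 2 1 ![(α : ℂ)] lowerParam c ↔ α - 1 < c ∧ c < 0 := by
  simp only [IsMeijerContour, Fin.forall_fin_one, Fin.forall_fin_two, lowerParam]
  norm_num
  intros
  linarith

section LaplaceRepresentation

variable {κ z c : ℝ}

/-- The two-variable integrand whose marginal in the second variable is the Mellin–Barnes
integrand. -/
noncomputable def meijerDoubleIntegrand (κ z c t y : ℝ) : ℂ :=
  (2 * Real.sqrt Real.pi * ((4 * z : ℝ) : ℂ) ^ ((c : ℂ) + t * Complex.I) *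
      Complex.Gamma (((-(2 * c) : ℝ) : ℂ) + ((-2 * t : ℝ) : ℂ) * Complex.I)) *
    ((Real.exp (-y) : ℂ) * (y : ℂ) ^ ((κ : ℂ) + ((c : ℂ) + t * Complex.I) - 1))

/-- On `Re s = c` the moduli of `(4z)^s` and `y^s` do not involve `t`, so the norm is a product of a
function of `t` and a function of `y`. The first is integrable since `c < 0`, the second since `-κ <
c`. -/
theorem integrable_meijerDoubleIntegrand (hz : 0 < z) (hc0 : c < 0) (hκc : -κ < c) :
    Integrable (Function.uncurry (meijerDoubleIntegrand κ z c))
      (volume.prod (volume.restrict (Ioi 0))) := by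
  have hσ : 0 < -(2 * c) := by linarith
  have hΓ := (integrable_Gamma_vertical hσ).comp_mul_left' (show (-2 : ℝ) ≠ 0 by norm_num)
  have hy : Integrable (fun y : ℝ => Real.exp (-y) * y ^ (κ + c - 1)) (volume.restrict (Ioi 0)) :=
    Real.GammaIntegral_convergent (by linarith)
  have hprod := (hΓ.norm.const_mul (2 * Real.sqrt Real.pi * (4 * z) ^ c)).mul_prod hy
  refine hprod.mono' ?_ ?_
  · have hΓm : Measurable fun t : ℝ =>
        Complex.Gamma (((-(2 * c) : ℝ) : ℂ) + ((-2 * t : ℝ) : ℂ) * Complex.I) :=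
      ((continuous_Gamma_vertical hσ).comp (continuous_const.mul continuous_id)).measurable
    have hΓm' := hΓm.comp (measurable_fst : Measurable (Prod.fst : ℝ × ℝ → ℝ))
    refine Measurable.aestronglyMeasurable ?_
    unfold Function.uncurry meijerDoubleIntegrand
    refine Measurable.mul (Measurable.mul ?_ hΓm') ?_
    · fun_prop
    · fun_prop
  · have hae : ∀ᵐ q : ℝ × ℝ ∂(volume.prod (volume.restrict (Ioi 0))), q.2 ∈ Ioi (0 : ℝ) :=
      Measure.quasiMeasurePreserving_snd.ae (ae_restrict_mem measurableSet_Ioi)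
    filter_upwards [hae] with q hq
    have hq' : 0 < q.2 := hq
    have h4z : 0 < 4 * z := by positivity
    simp only [Function.uncurry, meijerDoubleIntegrand, norm_mul,
      Complex.norm_cpow_eq_rpow_re_of_pos hq', Complex.norm_cpow_eq_rpow_re_of_pos h4z,
      Complex.norm_real]
    simp [abs_of_nonneg (Real.sqrt_nonneg Real.pi)]

theorem meijerIntegrand_eq_integral (hz : 0 < z) (hκc : -κ < c) (t : ℝ) :
    meijerIntegrand 2 1 ![((1 - κ : ℝ) : ℂ)] lowerParam (z : ℂ) c t =
      ∫ y in Ioi (0 : ℝ), meijerDoubleIntegrand κ z c t y := by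
  unfold meijerIntegrand meijerDoubleIntegrand
  rw [meijerKernel_two_one, integral_const_mul]
  set s : ℂ := (c : ℂ) + t * Complex.I with hs
  have hre : (0 : ℝ) < (κ + s : ℂ).re := by simp [hs]; linarith
  have hG : ∫ y in Ioi (0 : ℝ), (Real.exp (-y) : ℂ) * (y : ℂ) ^ ((κ : ℂ) + s - 1) =
      Complex.Gamma (κ + s) := by
    rw [Complex.Gamma_eq_integral hre, Complex.GammaIntegral]
  rw [hG]
  have h4 : ((4 * z : ℝ) : ℂ) ^ s = (4 : ℂ) ^ s * (z : ℂ) ^ s := by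
    rw [Complex.ofReal_mul, Complex.mul_cpow_ofReal_nonneg (by norm_num) hz.le]
    norm_num
  rw [h4, show (1 : ℂ) - ((1 - κ : ℝ) : ℂ) + s = κ + s by push_cast; ring,
    show ((-(2 * c) : ℝ) : ℂ) + ((-2 * t : ℝ) : ℂ) * Complex.I = -(2 * s) by
      rw [hs]; push_cast; ring]
  ring

/-- With `x = 2√(zy)` one has `(4zy)^s = x^(2s)`, so the substitution `u = -2t` reduces this to
Mellin inversion on the line of abscissa `-2c`. Its Jacobian `1/2` cancels the 2 from duplication.
-/
theorem integral_meijerDoubleIntegrand_left (hz : 0 < z) (hc0 : c < 0) {y : ℝ} (hy : 0 < y) :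
    ∫ t : ℝ, meijerDoubleIntegrand κ z c t y =
      2 * Real.pi * ((Real.sqrt Real.pi *
        (y ^ (κ - 1) * Real.exp (-y) * Real.exp (-(2 * Real.sqrt (z * y)))) : ℝ) : ℂ) := by
  have hσ : 0 < -(2 * c) := by linarith
  set x : ℝ := 2 * Real.sqrt (z * y) with hx
  have hx0 : 0 < x := by positivity
  have hx2 : x ^ 2 = 4 * z * y := by
    rw [hx, mul_pow, Real.sq_sqrt (by positivity)]; ring
  clear_value x
  have hinv := integral_cpow_mul_Gamma_vertical hσ hx0
  have key : ∀ t : ℝ, meijerDoubleIntegrand κ z c t y =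
      (2 * Real.sqrt Real.pi * ((Real.exp (-y) : ℂ) * (y : ℂ) ^ ((κ : ℂ) - 1))) *
      (fun u : ℝ => (x : ℂ) ^ (-(((-(2 * c) : ℝ) : ℂ) + u * Complex.I)) *
        Complex.Gamma (((-(2 * c) : ℝ) : ℂ) + u * Complex.I)) (-2 * t) := by
    intro t
    simp only [meijerDoubleIntegrand]
    have hpow : (x : ℂ) ^ (-(((-(2 * c) : ℝ) : ℂ) + ((-2 * t : ℝ) : ℂ) * Complex.I)) =
        ((4 * z : ℝ) : ℂ) ^ ((c : ℂ) + t * Complex.I) * (y : ℂ) ^ ((c : ℂ) + t * Complex.I) := by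
      rw [← Complex.mul_cpow_ofReal_nonneg (by positivity) hy.le, ← Complex.ofReal_mul, ← hx2,
        show -(((-(2 * c) : ℝ) : ℂ) + ((-2 * t : ℝ) : ℂ) * Complex.I) =
          ((c : ℂ) + t * Complex.I) + ((c : ℂ) + t * Complex.I) by push_cast; ring,
        Complex.cpow_add _ _ (Complex.ofReal_ne_zero.mpr hx0.ne'), sq, Complex.ofReal_mul,
        Complex.mul_cpow_ofReal_nonneg hx0.le hx0.le]
    rw [hpow, show (κ : ℂ) + ((c : ℂ) + t * Complex.I) - 1 =
      (κ - 1) + ((c : ℂ) + t * Complex.I) by ring,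
      Complex.cpow_add _ _ (Complex.ofReal_ne_zero.mpr hy.ne')]
    ring
  simp_rw [key]
  rw [integral_const_mul, Measure.integral_comp_mul_left (fun u : ℝ =>
    (x : ℂ) ^ (-(((-(2 * c) : ℝ) : ℂ) + u * Complex.I)) *
      Complex.Gamma (((-(2 * c) : ℝ) : ℂ) + u * Complex.I)), hinv, Complex.real_smul]
  have hyp : (y : ℂ) ^ ((κ : ℂ) - 1) = ((y ^ (κ - 1) : ℝ) : ℂ) := by
    rw [Complex.ofReal_cpow hy.le]; push_cast; rfl
  rw [hyp, show |(-2 : ℝ)⁻¹| = 1 / 2 by norm_num [abs_of_pos]]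
  push_cast
  ring

theorem integrable_meijerIntegrand_two_one (hz : 0 < z) (hc0 : c < 0) (hκc : -κ < c) :
    Integrable (meijerIntegrand 2 1 ![((1 - κ : ℝ) : ℂ)] lowerParam (z : ℂ) c) := by
  have h := (integrable_meijerDoubleIntegrand hz hc0 hκc).integral_prod_left
  refine h.congr (ae_of_all _ fun t => ?_)
  exact (meijerIntegrand_eq_integral hz hκc t).symm

/-- The `G^{2,1}_{1,2}` line integral as a Laplace-type integral; in particular it does not depend
on the separating line. -/
theorem meijerLineIntegral_two_one (hz : 0 < z) (hc0 : c < 0) (hκc : -κ < c) :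
    meijerLineIntegral 2 1 ![((1 - κ : ℝ) : ℂ)] lowerParam (z : ℂ) c =
      ((Real.sqrt Real.pi * ∫ y in Ioi (0 : ℝ),
        y ^ (κ - 1) * Real.exp (-y) * Real.exp (-(2 * Real.sqrt (z * y))) : ℝ) : ℂ) := by
  unfold meijerLineIntegral
  simp_rw [meijerIntegrand_eq_integral hz hκc]
  rw [integral_integral_swap (integrable_meijerDoubleIntegrand hz hc0 hκc),
    setIntegral_congr_fun measurableSet_Ioi
      (fun y hy => integral_meijerDoubleIntegrand_left hz hc0 hy), integral_const_mul,
    integral_complex_ofReal, integral_const_mul, ← mul_assoc, one_div,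
    inv_mul_cancel₀ (by simp [Real.pi_ne_zero]), one_mul]

theorem meijerG_two_one_eq_lineIntegral {α : ℝ} (hz : 0 < z)
    (hc : IsMeijerContour 2 1 ![(α : ℂ)] lowerParam c) :
    meijerG 2 1 ![(α : ℂ)] lowerParam (z : ℂ) =
      meijerLineIntegral 2 1 ![(α : ℂ)] lowerParam (z : ℂ) c := by
  have h : ∃ c, IsMeijerContour 2 1 ![(α : ℂ)] lowerParam c := ⟨c, hc⟩
  rw [meijerG, dif_pos h]
  -- The chosen abscissa is kept arbitrary: both line integrals equal the same Laplace integral,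
  -- which is free of `c`.
  generalize h.choose_spec = hc'
  generalize h.choose = c' at hc'
  obtain ⟨κ, rfl⟩ : ∃ κ, α = 1 - κ := ⟨1 - α, by ring⟩
  obtain ⟨h1, h2⟩ := isMeijerContour_two_one_iff.mp hc'
  obtain ⟨h3, h4⟩ := isMeijerContour_two_one_iff.mp hc
  rw [meijerLineIntegral_two_one hz h4 (by linarith),
    meijerLineIntegral_two_one hz h2 (by linarith)]

theorem meijerG_two_one_eq_integral (hκ : 0 < κ) (hz : 0 < z) :
    meijerG 2 1 ![((1 - κ : ℝ) : ℂ)] lowerParam (z : ℂ) =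
      ((Real.sqrt Real.pi * ∫ y in Ioi (0 : ℝ),
        y ^ (κ - 1) * Real.exp (-y) * Real.exp (-(2 * Real.sqrt (z * y))) : ℝ) : ℂ) := by
  -- The midpoint of the admissible interval `(-κ, 0)`.
  have hc : IsMeijerContour 2 1 ![((1 - κ : ℝ) : ℂ)] lowerParam (-κ / 2) :=
    isMeijerContour_two_one_iff.mpr ⟨by linarith, by linarith⟩
  rw [meijerG_two_one_eq_lineIntegral hz hc,
    meijerLineIntegral_two_one hz (by linarith) (by linarith)]

end LaplaceRepresentation

/-! ### The CDF at integer shape, and the integrals it produces. -/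

/-- The lower incomplete gamma function at a positive integer shape. -/
theorem lowerIncGamma_natCast_div_Gamma {d : ℕ} (hd : 1 ≤ d) (x : ℝ) :
    lowerIncGamma d x / Real.Gamma d =
      1 - Real.exp (-x) * ∑ p ∈ Finset.range d, x ^ p / (p.factorial : ℝ) := by
  obtain ⟨n, rfl⟩ := Nat.exists_eq_add_of_le' hd
  -- The derivative telescopes, leaving only the top term. At `t = 0` only the `p = 0` summand
  -- survives, which supplies the leading 1.
  have hderiv : ∀ n : ℕ, ∀ t : ℝ, HasDerivAt
      (fun t => -(Real.exp (-t) * ∑ p ∈ Finset.range (n + 1), t ^ p / (p.factorial : ℝ)))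
      (t ^ n * Real.exp (-t) / n.factorial) t := by
    intro n t
    have hexp : HasDerivAt (fun t : ℝ => Real.exp (-t)) (-Real.exp (-t)) t := by
      simpa using (hasDerivAt_neg t).exp
    induction n with
    | zero => simpa using! hexp.neg
    | succ n ih =>
      have hpow : HasDerivAt (fun t : ℝ => t ^ (n + 1) / ((n + 1).factorial : ℝ))
          (t ^ n / n.factorial) t := by
        refine ((hasDerivAt_pow (n + 1) t).div_const _).congr_deriv ?_
        rw [Nat.factorial_succ]
        push_cast
        field_simp
      have h := ih.sub (hexp.mul hpow)
      refine (h.congr_deriv ?_).congr_of_eventuallyEq (Filter.Eventually.of_forall fun u => ?_)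
      · ring
      · simp only [Pi.sub_apply, Pi.mul_apply]
        rw [Finset.sum_range_succ _ (n + 1)]
        ring
  have hfac : (n.factorial : ℝ) ≠ 0 := Nat.cast_ne_zero.mpr n.factorial_ne_zero
  have hint := intervalIntegral.integral_eq_sub_of_hasDerivAt (a := 0) (b := x)
    (fun t _ => hderiv n t) (Continuous.intervalIntegrable (by fun_prop) _ _)
  have hlow : lowerIncGamma ((n + 1 : ℕ) : ℝ) x = ∫ t in (0 : ℝ)..x, t ^ n * Real.exp (-t) := by
    unfold lowerIncGamma
    simp [Real.rpow_natCast]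
  rw [hlow, Nat.cast_succ, Real.Gamma_nat_eq_factorial, ← intervalIntegral.integral_div, hint]
  simp [Finset.sum_range_succ']
  ring

theorem cascadeCDF_natCast {d : ℕ} (hd : 1 ≤ d) (ζ x : ℝ) :
    cascadeCDF d ζ x = 1 - Real.exp (-(Real.sqrt x / ζ)) *
      ∑ p ∈ Finset.range d, (Real.sqrt x / ζ) ^ p / (p.factorial : ℝ) :=
  lowerIncGamma_natCast_div_Gamma hd _

theorem continuous_cascadeCDF {d : ℕ} (hd : 1 ≤ d) (ζ : ℝ) : Continuous (cascadeCDF d ζ) := by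
  rw [funext (cascadeCDF_natCast hd ζ)]
  fun_prop

theorem integrableOn_rpow_mul_exp_neg_mul {κ β : ℝ} (hκ : 0 < κ) (hβ : 0 < β) :
    IntegrableOn (fun y : ℝ => y ^ (κ - 1) * Real.exp (-(β * y))) (Ioi 0) := by
  simpa using integrableOn_rpow_mul_exp_neg_mul_rpow (p := 1) (s := κ - 1) (b := β)
    (by linarith) one_pos hβ

theorem integrableOn_rpow_mul_exp_mul_exp_sqrt {κ β A : ℝ} (hκ : 0 < κ) (hβ : 0 < β)
    (hA : 0 ≤ A) :
    IntegrableOn (fun y : ℝ => y ^ (κ - 1) * Real.exp (-(β * y)) * Real.exp (-(A * Real.sqrt y)))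
      (Ioi 0) := by
  refine (integrableOn_rpow_mul_exp_neg_mul hκ hβ).mono' (by fun_prop) ?_
  filter_upwards [ae_restrict_mem measurableSet_Ioi] with y hy
  have hy' : (0 : ℝ) < y := hy
  have h1 : Real.exp (-(A * Real.sqrt y)) ≤ 1 := Real.exp_le_one_iff.mpr (by
    have := Real.sqrt_nonneg y
    nlinarith)
  rw [Real.norm_of_nonneg (by positivity)]
  exact mul_le_of_le_one_right (by positivity) h1

/-- Scaling `y` by `β` normalises the rate to 1. The constant `A²/(4β)` is forced by `2√(A²/(4β) ·
βy) = A√y`, and it becomes the argument of the G-function. -/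
theorem integral_rpow_mul_exp_mul_exp_sqrt {κ β A : ℝ} (hβ : 0 < β) (hA : 0 ≤ A) :
    ∫ y in Ioi (0 : ℝ), y ^ (κ - 1) * Real.exp (-(β * y)) * Real.exp (-(A * Real.sqrt y)) =
      β ^ (-κ) * ∫ y in Ioi (0 : ℝ), y ^ (κ - 1) * Real.exp (-y) *
        Real.exp (-(2 * Real.sqrt (A ^ 2 / (4 * β) * y))) := by
  have h := integral_comp_mul_left_Ioi (fun y : ℝ => y ^ (κ - 1) * Real.exp (-y) *
    Real.exp (-(2 * Real.sqrt (A ^ 2 / (4 * β) * y)))) 0 hβ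
  have hcongr : ∀ y ∈ Ioi (0 : ℝ), (β * y) ^ (κ - 1) * Real.exp (-(β * y)) *
      Real.exp (-(2 * Real.sqrt (A ^ 2 / (4 * β) * (β * y)))) =
      β ^ (κ - 1) *
        (y ^ (κ - 1) * Real.exp (-(β * y)) * Real.exp (-(A * Real.sqrt y))) := by
    intro y hy
    have hy' : (0 : ℝ) < y := hy
    have hs : 2 * Real.sqrt (A ^ 2 / (4 * β) * (β * y)) = A * Real.sqrt y := by
      rw [show A ^ 2 / (4 * β) * (β * y) = (A / 2) ^ 2 * y by field_simp; norm_num,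
        Real.sqrt_mul (by positivity), Real.sqrt_sq (by positivity)]
      ring
    rw [hs, Real.mul_rpow hβ.le hy'.le]
    ring
  rw [setIntegral_congr_fun measurableSet_Ioi hcongr, integral_const_mul, mul_zero,
    smul_eq_mul] at h
  have hne : β ^ (κ - 1) ≠ 0 := (Real.rpow_pos_of_pos hβ _).ne'
  rw [← mul_right_inj' hne, h, ← mul_assoc, ← Real.rpow_add hβ,
    show κ - 1 + -κ = -1 by ring, Real.rpow_neg_one]

/-! ### Termwise evaluation of `ξ₁`. -/

section Evaluation

variable {N : ℕ} {md Od lam psi Ups ζ : ℝ} {d : ℕ}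

theorem xi1Integrand_eq (hlam : 0 < lam) (hpsi : 0 < psi)
    (hUps : 0 < Ups) (hd : 1 ≤ d) {y : ℝ} (hy : 0 < y) :
    xi1Integrand N md Od lam psi Ups ζ d y =
      (md / Od) ^ (md * N) / Real.Gamma (md * N) *
          (y ^ (md * N - 1) * Real.exp (-(md / Od * y))) -
        ∑ p ∈ Finset.range d, (md / Od) ^ (md * N) / Real.Gamma (md * N) *
          ((1 / ζ * Real.sqrt (Ups * lam / psi)) ^ p / p.factorial) *
          (y ^ (md * N + p / 2 - 1) * Real.exp (-(md / Od * y)) *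
            Real.exp (-((1 / ζ * Real.sqrt (Ups * lam / psi)) * Real.sqrt y))) := by
  have hx : Real.sqrt (lam * Ups * y / psi) / ζ =
      (1 / ζ * Real.sqrt (Ups * lam / psi)) * Real.sqrt y := by
    rw [show lam * Ups * y / psi = (Ups * lam / psi) * y by ring, Real.sqrt_mul (by positivity)]
    ring
  rw [xi1Integrand, cascadeCDF_natCast hd, hx, gammaPDFReal, if_pos hy.le, mul_sub, mul_one,
    Finset.mul_sum, Finset.mul_sum, mul_assoc]
  congr 1
  refine Finset.sum_congr rfl fun p _ => ?_
  -- The factor `√y ^ p` from the CDF raises the Gamma exponent by `p/2`.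
  have hpow : y ^ (md * N + p / 2 - 1) = y ^ (md * N - 1) * Real.sqrt y ^ p := by
    rw [show md * N + (p : ℝ) / 2 - 1 = (md * N - 1) + 1 / 2 * p by ring, Real.rpow_add hy,
      Real.rpow_mul hy.le, Real.rpow_natCast, ← Real.sqrt_eq_rpow]
  rw [hpow, mul_pow _ (Real.sqrt y)]
  ring

theorem integrableOn_xi1Integrand (hN : 1 ≤ N) (hmd : 0 < md) (hOd : 0 < Od) (hlam : 0 < lam)
    (hpsi : 0 < psi) (hUps : 0 < Ups) (hζ : 0 < ζ) (hd : 1 ≤ d) :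
    IntegrableOn (xi1Integrand N md Od lam psi Ups ζ d) (Ioi 0) := by
  have hN' : (0 : ℝ) < N := by exact_mod_cast hN
  refine IntegrableOn.congr_fun ?_
    (fun y hy => (xi1Integrand_eq hlam hpsi hUps hd hy).symm) measurableSet_Ioi
  refine Integrable.sub ((integrableOn_rpow_mul_exp_neg_mul (by positivity)
    (by positivity)).const_mul _) (integrable_finsetSum _ fun p _ => Integrable.const_mul ?_ _)
  exact integrableOn_rpow_mul_exp_mul_exp_sqrt (by positivity) (by positivity) (by positivity)

theorem xi1_eq_xi1ClosedForm (hN : 1 ≤ N) (hmd : 0 < md) (hOd : 0 < Od) (hlam : 0 < lam)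
    (hpsi : 0 < psi) (hUps : 0 < Ups) (hζ : 0 < ζ) (hd : 1 ≤ d) :
    (xi1 N md Od lam psi Ups ζ d : ℂ) = xi1ClosedForm N md Od lam psi Ups ζ d := by
  have hN' : (0 : ℝ) < N := by exact_mod_cast hN
  have hβ : 0 < md / Od := by positivity
  have hk : 0 < md * N := by positivity
  set A : ℝ := 1 / ζ * Real.sqrt (Ups * lam / psi) with hA
  have hA0 : 0 ≤ A := by positivity
  have hz : meijerArg md Od lam psi Ups ζ = A ^ 2 / (4 * (md / Od)) := by
    rw [hA, mul_pow, Real.sq_sqrt (by positivity), meijerArg]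
    field_simp
  have hz0 : 0 < meijerArg md Od lam psi Ups ζ := by
    unfold meijerArg; positivity
  have hΓ : Real.Gamma (md * N) ≠ 0 := (Real.Gamma_pos_of_pos hk).ne'
  have hmain : ∫ y in Ioi (0 : ℝ), (md / Od) ^ (md * N) / Real.Gamma (md * N) *
      (y ^ (md * N - 1) * Real.exp (-(md / Od * y))) = 1 := by
    rw [integral_const_mul, Real.integral_rpow_mul_exp_neg_mul_Ioi hk hβ, one_div,
      Real.inv_rpow hβ.le]
    have := (Real.rpow_pos_of_pos hβ (md * N)).ne'
    field_simp
  have hterm : ∀ p : ℕ, IntegrableOn (fun y : ℝ => (md / Od) ^ (md * N) / Real.Gamma (md * N) *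
      (A ^ p / p.factorial) * (y ^ (md * N + p / 2 - 1) * Real.exp (-(md / Od * y)) *
        Real.exp (-(A * Real.sqrt y)))) (Ioi 0) := fun p =>
    (integrableOn_rpow_mul_exp_mul_exp_sqrt (by positivity) hβ hA0).const_mul _
  rw [xi1, setIntegral_congr_fun measurableSet_Ioi
      (fun y hy => xi1Integrand_eq hlam hpsi hUps hd hy),
    integral_sub ((integrableOn_rpow_mul_exp_neg_mul hk hβ).const_mul _)
      (integrable_finsetSum _ fun p _ => hterm p),
    hmain, integral_finsetSum _ fun p _ => hterm p, xi1ClosedForm]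
  rw [Complex.ofReal_sub, Complex.ofReal_one, Complex.ofReal_sum]
  congr 1
  refine Finset.sum_congr rfl fun p _ => ?_
  have hκ : 0 < md * N + (p : ℝ) / 2 := by positivity
  have hup : upperParam N md p = ![((1 - (md * N + (p : ℝ) / 2) : ℝ) : ℂ)] := by
    rw [upperParam, sub_sub]
  rw [hup, meijerG_two_one_eq_integral hκ hz0, integral_const_mul,
    integral_rpow_mul_exp_mul_exp_sqrt hβ hA0, hz, ← hA]
  rw [← Complex.ofReal_mul, Complex.ofReal_inj]
  set I := ∫ y in Ioi (0 : ℝ), y ^ (md * N + (p : ℝ) / 2 - 1) * Real.exp (-y) *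
    Real.exp (-(2 * Real.sqrt (A ^ 2 / (4 * (md / Od)) * y)))
  have hpow : (md / Od) ^ (-(md * N + (p : ℝ) / 2)) =
      ((md / Od) ^ (md * N))⁻¹ * (md / Od) ^ (-(p : ℝ) / 2) := by
    rw [← Real.rpow_neg hβ.le, ← Real.rpow_add hβ]
    congr 1; ring
  have hb := (Real.rpow_pos_of_pos hβ (md * N)).ne'
  have hsp : Real.sqrt Real.pi ≠ 0 := (Real.sqrt_pos.mpr Real.pi_pos).ne'
  rw [hpow]
  generalize (md / Od) ^ (-(p : ℝ) / 2) = r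
  field_simp

end Evaluation

/-! ### Gamma laws: moment generating functions, sums, and squares of Nakagami variables. -/

section GammaMGF

variable {a r : ℝ}

/-- Dropping the null point 0 avoids the value of `x ^ (a - 1)` there. -/
theorem gammaMeasure_eq_withDensity_restrict (a r : ℝ) :
    gammaMeasure a r = (volume.restrict (Ioi 0)).withDensity fun x =>
      ENNReal.ofReal (r ^ a / Real.Gamma a * x ^ (a - 1) * Real.exp (-(r * x))) := by
  rw [Measure.restrict_congr_set Ioi_ae_eq_Ici, ← withDensity_indicator measurableSet_Ici, gammaMeasure]
  congr 1
  ext x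
  rw [gammaPDF_eq, indicator_apply]
  split_ifs with h1 h2 h2
  · rfl
  · exact absurd h1 h2
  · exact absurd h2 h1
  · simp

theorem gammaMeasure_density_nonneg (ha : 0 < a) (hr : 0 < r) :
    ∀ᵐ x ∂(volume.restrict (Ioi (0 : ℝ))),
      0 ≤ r ^ a / Real.Gamma a * x ^ (a - 1) * Real.exp (-(r * x)) := by
  filter_upwards [ae_restrict_mem measurableSet_Ioi] with x hx
  have hx' : (0 : ℝ) < x := hx
  have := Real.Gamma_pos_of_pos ha
  positivity

theorem integral_gammaMeasure (ha : 0 < a) (hr : 0 < r) (f : ℝ → ℝ) :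
    ∫ x, f x ∂gammaMeasure a r =
      ∫ x in Ioi 0, r ^ a / Real.Gamma a * x ^ (a - 1) * Real.exp (-(r * x)) * f x := by
  rw [gammaMeasure_eq_withDensity_restrict,
    integral_withDensity_eq_integral_toReal_smul (by fun_prop)
      (ae_of_all _ fun _ => ENNReal.ofReal_lt_top)]
  refine integral_congr_ae ?_
  filter_upwards [gammaMeasure_density_nonneg ha hr] with x hx
  rw [ENNReal.toReal_ofReal hx, smul_eq_mul]

theorem integrable_gammaMeasure_iff (ha : 0 < a) (hr : 0 < r) {f : ℝ → ℝ} :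
    Integrable f (gammaMeasure a r) ↔ IntegrableOn
      (fun x => r ^ a / Real.Gamma a * x ^ (a - 1) * Real.exp (-(r * x)) * f x) (Ioi 0) := by
  rw [gammaMeasure_eq_withDensity_restrict, integrable_withDensity_iff_integrable_smul'
      (by fun_prop) (ae_of_all _ fun _ => ENNReal.ofReal_lt_top)]
  refine integrable_congr ?_
  filter_upwards [gammaMeasure_density_nonneg ha hr] with x hx
  rw [ENNReal.toReal_ofReal hx, smul_eq_mul]

theorem integrable_exp_mul_gammaMeasure_iff (ha : 0 < a) (hr : 0 < r) {t : ℝ} :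
    Integrable (fun x => Real.exp (t * x)) (gammaMeasure a r) ↔ t < r := by
  have hC : 0 < r ^ a / Real.Gamma a := by
    have := Real.Gamma_pos_of_pos ha
    positivity
  rw [integrable_gammaMeasure_iff ha hr]
  have heq : ∀ x : ℝ, r ^ a / Real.Gamma a * x ^ (a - 1) * Real.exp (-(r * x)) *
      Real.exp (t * x) = r ^ a / Real.Gamma a * (x ^ (a - 1) * Real.exp (-((r - t) * x))) := by
    intro x
    rw [mul_assoc, ← Real.exp_add, mul_assoc]
    ring_nf
  simp_rw [heq]
  constructor
  · intro h
    by_contra! hrt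
    -- For `t ≥ r` the integrand dominates `x ^ (a - 1)`, and no power is integrable on the whole
    -- half-line.
    refine not_integrableOn_Ioi_rpow (a - 1) ?_
    have h' : IntegrableOn (fun x : ℝ => x ^ (a - 1) * Real.exp (-((r - t) * x))) (Ioi 0) := by
      refine (h.const_mul (r ^ a / Real.Gamma a)⁻¹).congr (ae_of_all _ fun x => ?_)
      simp only
      rw [← mul_assoc, inv_mul_cancel₀ hC.ne', one_mul]
    refine h'.mono' (by fun_prop) ?_
    filter_upwards [ae_restrict_mem measurableSet_Ioi] with x hx
    have hx' : (0 : ℝ) < x := hx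
    rw [Real.norm_of_nonneg (by positivity)]
    refine le_mul_of_one_le_right (by positivity) (Real.one_le_exp ?_)
    nlinarith
  · intro h
    exact (integrableOn_rpow_mul_exp_neg_mul ha (sub_pos.mpr h)).const_mul _

/-- The 0 is the default value of a divergent integral; recording it allows generating functions to
be compared on all of `ℝ`. -/
theorem mgf_gammaMeasure (ha : 0 < a) (hr : 0 < r) (t : ℝ) :
    mgf id (gammaMeasure a r) t = if t < r then (r / (r - t)) ^ a else 0 := by
  split_ifs with h
  · have hΓ := (Real.Gamma_pos_of_pos ha).ne'
    have hrt : 0 < r - t := sub_pos.mpr h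
    rw [mgf, integral_gammaMeasure ha hr]
    have heq : ∀ x : ℝ, r ^ a / Real.Gamma a * x ^ (a - 1) * Real.exp (-(r * x)) *
        Real.exp (t * id x) =
          r ^ a / Real.Gamma a * (x ^ (a - 1) * Real.exp (-((r - t) * x))) := by
      intro x
      rw [id, mul_assoc, ← Real.exp_add, mul_assoc]
      ring_nf
    simp_rw [heq]
    rw [integral_const_mul, Real.integral_rpow_mul_exp_neg_mul_Ioi ha hrt, one_div,
      Real.inv_rpow hrt.le, Real.div_rpow hr.le hrt.le]
    field_simp
  · exact mgf_undef fun hint => h ((integrable_exp_mul_gammaMeasure_iff ha hr).mp hint)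

end GammaMGF

/-- Gamma laws are determined by their moment generating function. -/
theorem eq_gammaMeasure_of_mgf_eq {a r : ℝ} (ha : 0 < a) (hr : 0 < r) {μ : Measure ℝ}
    [IsProbabilityMeasure μ] (h : mgf id μ = mgf id (gammaMeasure a r)) :
    μ = gammaMeasure a r := by
  have := isProbabilityMeasure_gammaMeasure ha hr
  refine Measure.ext_of_charFun (funext fun t => ?_)
  have hset : integrableExpSet id (gammaMeasure a r) = Iio r := by
    ext t
    exact integrable_exp_mul_gammaMeasure_iff ha hr
  -- The complex generating functions agree on the strip `Re z < r`. It contains the imaginary axis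
  -- because `r > 0`, and there they are the characteristic functions.
  have hEq := eqOn_complexMGF_of_mgf h.symm (x := (t * Complex.I : ℂ)) (by simp [hset, hr])
  rw [← complexMGF_id_mul_I, ← complexMGF_id_mul_I, hEq]

/-- The sum of finitely many independent Gamma variables with a common rate is Gamma. -/
theorem map_sum_eq_gammaMeasure {W : Type*} [MeasurableSpace W] {P : Measure W} {N : ℕ}
    (hN : 1 ≤ N) {a r : ℝ} (ha : 0 < a) (hr : 0 < r) {Z : Fin N → W → ℝ}
    (hZ : ∀ n, Measurable (Z n)) (hlaw : ∀ n, P.map (Z n) = gammaMeasure a r)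
    (hind : iIndepFun Z P) :
    P.map (fun w => ∑ n, Z n w) = gammaMeasure (a * N) r := by
  have hN' : (0 : ℝ) < N := by exact_mod_cast hN
  have hP : IsProbabilityMeasure P := hind.isProbabilityMeasure
  have hS : Measurable fun w => ∑ n, Z n w := Finset.measurable_sum _ fun n _ => hZ n
  have : IsProbabilityMeasure (P.map fun w => ∑ n, Z n w) :=
    Measure.isProbabilityMeasure_map hS.aemeasurable
  refine eq_gammaMeasure_of_mgf_eq (by positivity) hr (funext fun t => ?_)
  have hsum : (fun w => ∑ n, Z n w) = ∑ n, Z n := by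
    ext w
    simp
  rw [mgf_id_map hS.aemeasurable, hsum, hind.mgf_sum hZ]
  have hn : ∀ n, mgf (Z n) P t = if t < r then (r / (r - t)) ^ a else 0 := fun n => by
    rw [← mgf_id_map (hZ n).aemeasurable, hlaw, mgf_gammaMeasure ha hr]
  rw [Finset.prod_congr rfl fun n _ => hn n, mgf_gammaMeasure (by positivity) hr,
    Finset.prod_const, Finset.card_univ, Fintype.card_fin]
  split_ifs with h
  · have hrt : 0 < r - t := sub_pos.mpr h
    rw [Real.rpow_mul (by positivity), Real.rpow_natCast]
  -- For `t ≥ r` both sides carry the default value; `0 ^ N = 0` needs `N ≥ 1`.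
  · exact zero_pow (by omega)

/-- The square of a Nakagami variable is Gamma distributed. -/
theorem map_sq_nakagamiMeasure {m Om : ℝ} (hm : 0 < m) (hOm : 0 < Om) :
    (nakagamiMeasure m Om).map (fun x => x ^ 2) = gammaMeasure m (m / Om) := by
  have himg : (fun x : ℝ => x ^ 2) '' Ioi 0 = Ioi 0 := by
    ext y
    constructor
    · rintro ⟨x, hx, rfl⟩
      exact pow_pos (mem_Ioi.mp hx) 2
    · intro hy
      exact ⟨Real.sqrt y, Real.sqrt_pos.mpr hy, Real.sq_sqrt (mem_Ioi.mp hy).le⟩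
  have hinj : InjOn (fun x : ℝ => x ^ 2) (Ioi 0) := fun x hx y hy h =>
    (sq_eq_sq₀ (mem_Ioi.mp hx).le (mem_Ioi.mp hy).le).mp h
  have hnak : nakagamiMeasure m Om = (volume.restrict (Ioi 0)).withDensity fun x =>
      ENNReal.ofReal (2 * m ^ m / (Real.Gamma m * Om ^ m) * x ^ (2 * m - 1) *
        Real.exp (-(m / Om) * x ^ 2)) := by
    rw [← withDensity_indicator measurableSet_Ioi, nakagamiMeasure]
    congr 1
    ext x
    rw [indicator_apply]
    split_ifs with h1 h2 h2
    · rfl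
    · exact absurd h1 h2
    · exact absurd h2 h1
    · simp
  refine Measure.ext fun s hs => ?_
  have hs' : MeasurableSet ((fun x : ℝ => x ^ 2) ⁻¹' s) := hs.preimage (by fun_prop)
  rw [Measure.map_apply (by fun_prop) hs, hnak, gammaMeasure_eq_withDensity_restrict,
    withDensity_apply _ hs', withDensity_apply _ hs, ← lintegral_indicator hs',
    ← lintegral_indicator hs]
  conv_rhs => rw [← himg]
  rw [lintegral_image_eq_lintegral_abs_deriv_mul measurableSet_Ioi
    (fun x _ => by simpa using (hasDerivAt_pow 2 x).hasDerivWithinAt) hinj]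
  refine setLIntegral_congr_fun measurableSet_Ioi fun x hx => ?_
  have hx' : (0 : ℝ) < x := hx
  by_cases hxs : x ^ 2 ∈ s
  · rw [indicator_of_mem (show x ∈ (fun x : ℝ => x ^ 2) ⁻¹' s from hxs), indicator_of_mem hxs,
      ← ENNReal.ofReal_mul (abs_nonneg _), abs_of_pos (by positivity)]
    congr 1
    -- The factor `x` split off here is absorbed by the Jacobian `2x` of squaring.
    have hpow : x ^ (2 * m - 1) = x * (x ^ 2) ^ (m - 1) := by
      rw [← Real.rpow_natCast, ← Real.rpow_mul hx'.le]
      nth_rw 2 [← Real.rpow_one x]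
      rw [← Real.rpow_add hx']
      congr 1
      push_cast
      ring
    rw [hpow, Real.div_rpow hm.le hOm.le, neg_mul]
    have hO := (Real.rpow_pos_of_pos hOm m).ne'
    have hΓ := (Real.Gamma_pos_of_pos hm).ne'
    field_simp
  · rw [indicator_of_notMem (show x ∉ (fun x : ℝ => x ^ 2) ⁻¹' s from hxs),
      indicator_of_notMem hxs, mul_zero]

/-! ### The outage probability as `ξ₁`. -/

/-- A real variable with a continuous distribution function has no atoms. -/
theorem measure_Iio_eq_of_continuous_cdf {μ : Measure ℝ} [IsProbabilityMeasure μ] {F : ℝ → ℝ}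
    (hF : Continuous F) (h : ∀ x, μ.real (Iic x) = F x) (x : ℝ) : μ.real (Iio x) = F x := by
  refine le_antisymm ((measureReal_mono Iio_subset_Iic_self).trans_eq (h x)) ?_
  -- For `y < x`, `F y` is the mass of `Iic y`, hence at most that of `Iio x`; let `y` increase to
  -- `x`.
  refine le_of_tendsto (hF.tendsto x |>.mono_left (nhdsWithin_le_nhds (s := Iio x))) ?_
  filter_upwards [self_mem_nhdsWithin] with y hy
  rw [← h y]
  exact measureReal_mono (Iic_subset_Iio.mpr hy)

/-- Fubini for the product law of `(Y, X)`: for fixed `y > 0`, which holds almost surely, the event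
is `X < λΥy/ψ`. Strictness is harmless because the CDF is continuous. -/
theorem measureReal_ratio_lt_eq_xi1 {W : Type*} [MeasurableSpace W] {P : Measure W}
    [IsProbabilityMeasure P] {X Y : W → ℝ} (hX : Measurable X) (hY : Measurable Y)
    (hind : IndepFun X Y P) {N : ℕ} {md Od lam psi Ups ζ : ℝ} (hN : 1 ≤ N) (hmd : 0 < md)
    (hOd : 0 < Od) (hlam : 0 < lam) (hpsi : 0 < psi) {d : ℕ} (hd : 1 ≤ d)
    (hcdf : ∀ x : ℝ, P.real {w | X w ≤ x} = cascadeCDF d ζ x)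
    (hlaw : P.map Y = gammaMeasure (md * N) (md / Od)) :
    P.real {w | psi * X w / (lam * Y w) < Ups} = xi1 N md Od lam psi Ups ζ d := by
  have hN' : (0 : ℝ) < N := by exact_mod_cast hN
  have hβ : 0 < md / Od := by positivity
  have hk : 0 < md * N := by positivity
  have hpX : IsProbabilityMeasure (P.map X) := Measure.isProbabilityMeasure_map hX.aemeasurable
  have hpY : IsProbabilityMeasure (P.map Y) := Measure.isProbabilityMeasure_map hY.aemeasurable
  have hIio : ∀ x, (P.map X).real (Iio x) = cascadeCDF d ζ x :=
    measure_Iio_eq_of_continuous_cdf (continuous_cascadeCDF hd ζ) fun x => by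
      rw [map_measureReal_apply hX measurableSet_Iic, ← hcdf]
      rfl
  have hYpos : ∀ᵐ y ∂P.map Y, 0 < y := by
    rw [hlaw, gammaMeasure_eq_withDensity_restrict]
    exact (withDensity_absolutelyContinuous _ _).ae_le (ae_restrict_mem measurableSet_Ioi)
  have hS : MeasurableSet {q : ℝ × ℝ | psi * q.2 / (lam * q.1) < Ups} :=
    measurableSet_lt (by fun_prop) measurable_const
  have hpair : P.map (fun w => (Y w, X w)) = (P.map Y).prod (P.map X) :=
    (indepFun_iff_map_prod_eq_prod_map_map hY.aemeasurable hX.aemeasurable).mp hind.symm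
  have hmap : P.real {w | psi * X w / (lam * Y w) < Ups} =
      ((P.map Y).prod (P.map X)).real {q : ℝ × ℝ | psi * q.2 / (lam * q.1) < Ups} := by
    rw [← hpair, map_measureReal_apply (by fun_prop) hS]
    rfl
  have hfiber : ∀ᵐ y ∂P.map Y,
      (P.map X).real (Prod.mk y ⁻¹' {q : ℝ × ℝ | psi * q.2 / (lam * q.1) < Ups}) =
        cascadeCDF d ζ (lam * Ups * y / psi) := by
    filter_upwards [hYpos] with y hy
    rw [← hIio]
    congr 1
    ext x
    simp only [mem_preimage, mem_ofPred_eq, mem_Iio]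
    rw [div_lt_iff₀ (by positivity), lt_div_iff₀ hpsi]
    ring_nf
  rw [hmap, measureReal_def, Measure.prod_apply hS, ← integral_toReal
    (measurable_measure_prodMk_left hS).aemeasurable (ae_of_all _ fun _ => measure_lt_top _ _)]
  simp only [measureReal_def] at hfiber
  rw [integral_congr_ae hfiber, hlaw, integral_gammaMeasure hk hβ, xi1]
  refine setIntegral_congr_fun measurableSet_Ioi fun y hy => ?_
  simp only [xi1Integrand]
  rw [gammaPDFReal, if_pos (mem_Ioi.mp hy).le]

/-! ### Positivity of the matched mean and variance. -/

/-- Logarithmic convexity of `Γ` at the midpoint of `m` and `m + 1`. -/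
theorem Gamma_add_half_sq_le {m : ℝ} (hm : 0 < m) :
    Real.Gamma (m + 1 / 2) ^ 2 ≤ m * Real.Gamma m ^ 2 := by
  have h := Real.Gamma_mul_add_mul_le_rpow_Gamma_mul_rpow_Gamma (s := m) (t := m + 1)
    (a := 1 / 2) (b := 1 / 2) hm (by linarith) (by norm_num) (by norm_num) (by norm_num)
  have hΓ := Real.Gamma_pos_of_pos hm
  rw [show 1 / 2 * m + 1 / 2 * (m + 1) = m + 1 / 2 by ring, Real.Gamma_add_one hm.ne',
    ← Real.sqrt_eq_rpow, ← Real.sqrt_eq_rpow, ← Real.sqrt_mul hΓ.le,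
    show Real.Gamma m * (m * Real.Gamma m) = m * Real.Gamma m ^ 2 by ring] at h
  have h0 : 0 ≤ Real.Gamma (m + 1 / 2) := (Real.Gamma_pos_of_pos (by linarith)).le
  exact (Real.le_sqrt h0 (by positivity)).mp h

/-- A strict case of the logarithmic convexity of the Gamma function. -/
theorem Gamma_add_half_sq_lt {m : ℝ} (hm : 0 < m) :
    Real.Gamma (m + 1 / 2) ^ 2 < m * Real.Gamma m ^ 2 := by
  -- Strictness comes from shifting the weak inequality to `m + 1` and descending by the functional
  -- equation: `(m + 1/2)²` exceeds `m(m + 1)` by `1/4`.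
  have h := Gamma_add_half_sq_le (m := m + 1) (by linarith)
  rw [show m + 1 + 1 / 2 = (m + 1 / 2) + 1 by ring, Real.Gamma_add_one (by linarith),
    Real.Gamma_add_one hm.ne', mul_pow, mul_pow] at h
  have h0 : 0 < Real.Gamma (m + 1 / 2) := Real.Gamma_pos_of_pos (by linarith)
  have h1 : (m + 1 / 2) ^ 2 * Real.Gamma (m + 1 / 2) ^ 2 =
      m * (m + 1) * Real.Gamma (m + 1 / 2) ^ 2 + Real.Gamma (m + 1 / 2) ^ 2 / 4 := by ring
  have h2 : m * (m + 1) * Real.Gamma (m + 1 / 2) ^ 2 <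
      m * (m + 1) * (m * Real.Gamma m ^ 2) := by
    have := pow_pos h0 2
    linarith
  exact lt_of_mul_lt_mul_left h2 (by positivity)

theorem cascadeMean_pos {N : ℕ} (hN : 1 ≤ N) {mb md Ob Od : ℝ} (hmb : 0 < mb) (hmd : 0 < md)
    (hOb : 0 < Ob) (hOd : 0 < Od) : 0 < cascadeMean N mb md Ob Od := by
  have hN' : (0 : ℝ) < N := by exact_mod_cast hN
  have := Real.Gamma_pos_of_pos hmb
  have := Real.Gamma_pos_of_pos hmd
  have := Real.Gamma_pos_of_pos (show 0 < mb + 1 / 2 by linarith)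
  have := Real.Gamma_pos_of_pos (show 0 < md + 1 / 2 by linarith)
  unfold cascadeMean
  positivity

theorem cascadeVar_pos {N : ℕ} (hN : 1 ≤ N) {mb md Ob Od : ℝ} (hmb : 0 < mb) (hmd : 0 < md)
    (hOb : 0 < Ob) (hOd : 0 < Od) : 0 < cascadeVar N mb md Ob Od := by
  have hN' : (0 : ℝ) < N := by exact_mod_cast hN
  have hb := Real.Gamma_pos_of_pos hmb
  have hd := Real.Gamma_pos_of_pos hmd
  have hlt : Real.Gamma (mb + 1 / 2) ^ 2 * Real.Gamma (md + 1 / 2) ^ 2 <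
      (mb * Real.Gamma mb ^ 2) * (md * Real.Gamma md ^ 2) :=
    mul_lt_mul'' (Gamma_add_half_sq_lt hmb) (Gamma_add_half_sq_lt hmd) (sq_nonneg _)
      (sq_nonneg _)
  have hone : 1 / (mb * md) * (Real.Gamma (mb + 1 / 2) * Real.Gamma (md + 1 / 2) /
      (Real.Gamma mb * Real.Gamma md)) ^ 2 < 1 := by
    rw [div_pow, div_mul_div_comm, div_lt_one (by positivity), one_mul, mul_pow]
    linarith
  unfold cascadeVar
  have := sub_pos.mpr hone
  positivity

/-! ### Assembly of the statement. -/

theorem lemma1 (N : ℕ) (hN : 1 ≤ N) (mb md Ob Od : ℝ)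
    (hmb : 0 < mb) (hmd : 0 < md) (hOb : 0 < Ob) (hOd : 0 < Od)
    (lam psi Ups : ℝ) (hlam : 0 < lam) (hpsi : 0 < psi) (hUps : 0 < Ups)
    (δ ζ : ℝ)
    (hδ : δ = cascadeMean N mb md Ob Od ^ 2 / cascadeVar N mb md Ob Od)
    (hζ : ζ = cascadeVar N mb md Ob Od / cascadeMean N mb md Ob Od) :
    -- the moment-matched shape and scale are positive, so that `⌈δ⌉` is a positive integer
    (0 < δ ∧ 0 < ζ) ∧
    -- the G-functions below are given by convergent integrals, the same for all separating lines
    (∀ p : ℕ, (∃ c : ℝ, IsMeijerContour 2 1 (upperParam N md p) lowerParam c) ∧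
      ∀ c : ℝ, IsMeijerContour 2 1 (upperParam N md p) lowerParam c →
        Integrable (meijerIntegrand 2 1 (upperParam N md p) lowerParam
          (meijerArg md Od lam psi Ups ζ : ℂ) c) ∧
        meijerLineIntegral 2 1 (upperParam N md p) lowerParam
            (meijerArg md Od lam psi Ups ζ : ℂ) c =
          meijerG 2 1 (upperParam N md p) lowerParam (meijerArg md Od lam psi Ups ζ : ℂ)) ∧
    -- the evaluation, for every positive integer `d` used as the value of the shape
    (∀ d : ℕ, 1 ≤ d →
      IntegrableOn (xi1Integrand N md Od lam psi Ups ζ d) (Ioi 0) ∧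
      (xi1 N md Od lam psi Ups ζ d : ℂ) = xi1ClosedForm N md Od lam psi Ups ζ d) ∧
    -- in particular for the integer value `⌈δ⌉` of the shape, and for `δ` itself if it is integral
    (xi1 N md Od lam psi Ups ζ (⌈δ⌉₊ : ℝ) : ℂ) = xi1ClosedForm N md Od lam psi Ups ζ ⌈δ⌉₊ ∧
    (∀ d : ℕ, δ = d →
      (xi1 N md Od lam psi Ups ζ δ : ℂ) = xi1ClosedForm N md Od lam psi Ups ζ d) ∧
    -- `ξ₁` is the probability of `ψ X / (λ Y) < Υ` in the model
    (∀ d : ℕ, 1 ≤ d → ∀ {W : Type*} [MeasurableSpace W] (P : Measure W) [IsProbabilityMeasure P]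
      (X : W → ℝ) (g : Fin N → W → ℂ),
      Measurable X → (∀ n, Measurable (g n)) →
      (∀ n, P.map (fun w => ‖g n w‖) = nakagamiMeasure md Od) → iIndepFun g P →
      (∀ x : ℝ, P.real {w | X w ≤ x} = cascadeCDF d ζ x) →
      IndepFun X (fun w => ∑ n, ‖g n w‖ ^ 2) P →
      P.map (fun w => ∑ n, ‖g n w‖ ^ 2) = gammaMeasure (md * N) (md / Od) ∧
      P.real {w | psi * X w / (lam * ∑ n, ‖g n w‖ ^ 2) < Ups} =
        xi1 N md Od lam psi Ups ζ d) := by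
  have hmean := cascadeMean_pos hN hmb hmd hOb hOd
  have hvar := cascadeVar_pos hN hmb hmd hOb hOd
  have hδ0 : 0 < δ := by rw [hδ]; positivity
  have hζ0 : 0 < ζ := by rw [hζ]; positivity
  have hN' : (0 : ℝ) < N := by exact_mod_cast hN
  have hz0 : 0 < meijerArg md Od lam psi Ups ζ := by unfold meijerArg; positivity
  have hclosed : ∀ d : ℕ, 1 ≤ d →
      (xi1 N md Od lam psi Ups ζ d : ℂ) = xi1ClosedForm N md Od lam psi Ups ζ d :=
    fun d hd => xi1_eq_xi1ClosedForm hN hmd hOd hlam hpsi hUps hζ0 hd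
  refine ⟨⟨hδ0, hζ0⟩, fun p => ?_, fun d hd =>
    ⟨integrableOn_xi1Integrand hN hmd hOd hlam hpsi hUps hζ0 hd, hclosed d hd⟩,
    hclosed _ (Nat.one_le_ceil_iff.mpr hδ0), ?_, ?_⟩
  · have hκ : 0 < md * N + (p : ℝ) / 2 := by positivity
    have hup : upperParam N md p = ![((1 - (md * N + (p : ℝ) / 2) : ℝ) : ℂ)] := by
      rw [upperParam, sub_sub]
    rw [hup]
    refine ⟨⟨-(md * N + (p : ℝ) / 2) / 2,
      isMeijerContour_two_one_iff.mpr ⟨by linarith, by linarith⟩⟩, fun c hc => ?_⟩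
    obtain ⟨h1, h2⟩ := isMeijerContour_two_one_iff.mp hc
    exact ⟨integrable_meijerIntegrand_two_one hz0 h2 (by linarith),
      (meijerG_two_one_eq_lineIntegral hz0 hc).symm⟩
  · rintro d rfl
    exact hclosed d (Nat.cast_pos.mp hδ0)
  · intro d hd W _ P _ X g hX hg hlaw hind hcdf hXY
    have hsq : P.map (fun w => ∑ n, ‖g n w‖ ^ 2) = gammaMeasure (md * N) (md / Od) := by
      refine map_sum_eq_gammaMeasure hN hmd (by positivity) (Z := fun n w => ‖g n w‖ ^ 2)
        (fun n => by fun_prop) (fun n => ?_) (hind.comp (fun _ u => ‖u‖ ^ 2) fun _ => by fun_prop)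
      rw [← map_sq_nakagamiMeasure hmd hOd, ← hlaw n,
        Measure.map_map (by fun_prop) (by fun_prop)]
      rfl
    exact ⟨hsq, measureReal_ratio_lt_eq_xi1 hX (by fun_prop) hXY hN hmd hOd hlam hpsi hd hcdf hsq⟩
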